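/- Let $\mathbb{F}$ be a field of characteristic $3$ over which every polynomial of degree $2$ or $3$ has a root. An algebra over $\mathbb{F}$ is a vector space $\mathbb{A}$ with a bilinear product $\mathbb{A}\times\mathbb{A}\to\mathbb{A}$ (not assumed associative, commutative or unital); it is nontrivial if the product is not identically zero, and $\mathbb{A}^{op}$ is the same space with the product $\mathbf{u}*\mathbf{v}=\mathbf{v}\cdot\mathbf{u}$. A matrix $\begin{pmatrix}\alpha_1&\alpha_2&\alpha_3&\alpha_4\\ \beta_1&\beta_2&\beta_3&\beta_4\end{pmatrix}$ over $\mathbb{F}$ denotes the algebra with basis $e_1,e_2$ and product $$e_1e_1=\alpha_1e_1+\beta_1e_2,\quad e_1e_2=\alpha_2e_1+\beta_2e_2,\quad e_2e_1=\alpha_3e_1+\beta_3e_2,\quad e_2e_2=\alpha_4e_1+\beta_4e_2.$$ Put $$A_{1,3}(\alpha_1,\alpha_2,\alpha_4,\beta_1)=\begin{pmatrix}\alpha_1&\alpha_2&\alpha_2+1&\alpha_4\\ \beta_1&-\alpha_1&-\alpha_1+1&-\alpha_2\end{pmatrix},\quad A_{2,3}(\alpha_1,\beta_1,\beta_2)=\begin{pmatrix}\alpha_1&0&0&1\\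 \beta_1&\beta_2&1-\alpha_1&0\end{pmatrix},$$ $$A_{3,3}(\beta_1,\beta_2)=\begin{pmatrix}0&1&1&0\\ \beta_1&\beta_2&1&-1\end{pmatrix},\quad A_{4,3}(\alpha_1,\beta_2)=\begin{pmatrix}\alpha_1&0&0&0\\ 0&\beta_2&1-\alpha_1&0\end{pmatrix},\quad A_{5,3}(\alpha_1)=\begin{pmatrix}\alpha_1&0&0&0\\ 1&-\alpha_1-1&1-\alpha_1&0\end{pmatrix},$$ $$A_{9,3}=\begin{pmatrix}0&1&1&0\\ 1&0&0&-1\end{pmatrix},\quad A_{10,3}=\begin{pmatrix}0&1&1&0\\ 0&0&0&-1\end{pmatrix},\quad A_{11,3}=\begin{pmatrix}1&0&0&0\\ 1&-1&-1&0\end{pmatrix},\quad A_{12,3}=\begin{pmatrix}0&0&0&0\\ 1&0&0&0\end{pmatrix}.$$ Then, up to isomorphism, the nontrivial two-dimensional algebras $\mathbb{A}$ over $\mathbb{F}$ with $\mathbb{A}^{op}\cong\mathbb{A}$ are exactly the following, where $\alpha_1,\alpha_2,\beta_1$ are arbitrary elements of $\mathbb{F}$: $$A_{1,3}(\alpha_1,-\alpha_1,\alpha_2,\alpha_2),\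 A_{2,3}(\alpha_1,\beta_1,1-\alpha_1),\ A_{2,3}(0,0,-1),\ A_{3,3}(\beta_1,-1),\ A_{3,3}(\beta_1,1),$$ $$A_{4,3}(\alpha_1,1-\alpha_1),\ A_{4,3}(0,-1),\ A_{5,3}(0),\ A_{9,3},\ A_{10,3},\ A_{11,3},\ A_{12,3}.$$ That is, each listed algebra is nontrivial and isomorphic to its opposite; every nontrivial two-dimensional algebra isomorphic to its opposite is isomorphic to a listed one; and two listed algebras given by different matrices are isomorphic only in the case $A_{2,3}(\alpha_1,\beta_1,1-\alpha_1)\cong A_{2,3}(\alpha_1,-\beta_1,1-\alpha_1)$. -/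

import Mathlib

/-- A (not necessarily associative, unital or commutative) algebra over `F` is a vector space `V`
with a bilinear product `V × V → V`, given here as a bilinear map `μ`, so `μ u v` is `u · v`.
Two algebras are isomorphic if some linear equivalence of the underlying spaces respects the
products. -/
def AlgIso {F V W : Type*} [Field F] [AddCommGroup V] [Module F V] [AddCommGroup W] [Module F W]
    (μ : LinearMap.BilinMap F V V) (ν : LinearMap.BilinMap F W W) : Prop :=
  ∃ e : V ≃ₗ[F] W, ∀ u v : V, e (μ u v) = ν (e u) (e v)

/-- The opposite algebra, with product `u * v = v · u`. -/
def oppAlg {F V : Type*} [Field F] [AddCommGroup V] [Module F V]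
    (μ : LinearMap.BilinMap F V V) : LinearMap.BilinMap F V V :=
  μ.flip

/-- The algebra on `F ^ 2` whose matrix of structure constants with respect to the standard basis
is the `2 × 4` matrix `A = (α₁ α₂ α₃ α₄; β₁ β₂ β₃ β₄)`, that is `u · v = A (u ⊗ v)`. -/
def mscAlg {F : Type*} [Field F] (A : Matrix (Fin 2) (Fin 4) F) :
    LinearMap.BilinMap F (Fin 2 → F) (Fin 2 → F) :=
  LinearMap.mk₂ F
    (fun u v => A.mulVec ![u 0 * v 0, u 0 * v 1, u 1 * v 0, u 1 * v 1])
    (by intro u u' v; ext k; simp [Matrix.mulVec, dotProduct, Fin.sum_univ_four]; ring)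
    (by intro c u v; ext k; simp [Matrix.mulVec, dotProduct, Fin.sum_univ_four]; ring)
    (by intro u v v'; ext k; simp [Matrix.mulVec, dotProduct, Fin.sum_univ_four]; ring)
    (by intro c u v; ext k; simp [Matrix.mulVec, dotProduct, Fin.sum_univ_four]; ring)

/-- The columns of `A` are the products `e₁e₁`, `e₁e₂`, `e₂e₁`, `e₂e₂` of the standard basis
vectors, as they should be. -/
theorem mscAlg_basis {F : Type*} [Field F] (A : Matrix (Fin 2) (Fin 4) F) :
    mscAlg A ![1, 0] ![1, 0] = ![A 0 0, A 1 0] ∧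
    mscAlg A ![1, 0] ![0, 1] = ![A 0 1, A 1 1] ∧
    mscAlg A ![0, 1] ![1, 0] = ![A 0 2, A 1 2] ∧
    mscAlg A ![0, 1] ![0, 1] = ![A 0 3, A 1 3] := by
  refine ⟨?_, ?_, ?_, ?_⟩ <;> ext k <;> fin_cases k <;>
    simp [mscAlg, Matrix.mulVec, dotProduct, Fin.sum_univ_four]

/-- `A_{1,3}(α₁, α₂, α₄, β₁)`. -/
def A13 {F : Type*} [Field F] (α₁ α₂ α₄ β₁ : F) : Matrix (Fin 2) (Fin 4) F :=
  !![α₁, α₂, α₂ + 1, α₄; β₁, -α₁, -α₁ + 1, -α₂]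

/-- `A_{2,3}(α₁, β₁, β₂)`. -/
def A23 {F : Type*} [Field F] (α₁ β₁ β₂ : F) : Matrix (Fin 2) (Fin 4) F :=
  !![α₁, 0, 0, 1; β₁, β₂, 1 - α₁, 0]

/-- `A_{3,3}(β₁, β₂)`. -/
def A33 {F : Type*} [Field F] (β₁ β₂ : F) : Matrix (Fin 2) (Fin 4) F :=
  !![0, 1, 1, 0; β₁, β₂, 1, -1]

/-- `A_{4,3}(α₁, β₂)`. -/
def A43 {F : Type*} [Field F] (α₁ β₂ : F) : Matrix (Fin 2) (Fin 4) F :=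
  !![α₁, 0, 0, 0; 0, β₂, 1 - α₁, 0]

/-- `A_{5,3}(α₁)`. -/
def A53 {F : Type*} [Field F] (α₁ : F) : Matrix (Fin 2) (Fin 4) F :=
  !![α₁, 0, 0, 0; 1, -α₁ - 1, 1 - α₁, 0]

/-- `A_{9,3}`. -/
def A93 (F : Type*) [Field F] : Matrix (Fin 2) (Fin 4) F :=
  !![0, 1, 1, 0; 1, 0, 0, -1]

/-- `A_{10,3}`. -/
def A103 (F : Type*) [Field F] : Matrix (Fin 2) (Fin 4) F :=
  !![0, 1, 1, 0; 0, 0, 0, -1]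

/-- `A_{11,3}`. -/
def A113 (F : Type*) [Field F] : Matrix (Fin 2) (Fin 4) F :=
  !![1, 0, 0, 0; 1, -1, -1, 0]

/-- `A_{12,3}`. -/
def A123 (F : Type*) [Field F] : Matrix (Fin 2) (Fin 4) F :=
  !![0, 0, 0, 0; 1, 0, 0, 0]

/-- The list of structure matrices of the self-opposite algebras; the parameters are arbitrary
elements of `F`. -/
inductive IsListed {F : Type*} [Field F] : Matrix (Fin 2) (Fin 4) F → Prop
  | a1 (α₁ α₂ : F) : IsListed (A13 α₁ (-α₁) α₂ α₂)
  | a2 (α₁ β₁ : F) : IsListed (A23 α₁ β₁ (1 - α₁))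
  | a2_special : IsListed (A23 0 0 (-1))
  | a3_neg (β₁ : F) : IsListed (A33 β₁ (-1))
  | a3_pos (β₁ : F) : IsListed (A33 β₁ 1)
  | a4 (α₁ : F) : IsListed (A43 α₁ (1 - α₁))
  | a4_special : IsListed (A43 0 (-1))
  | a5 : IsListed (A53 0)
  | a9 : IsListed (A93 F)
  | a10 : IsListed (A103 F)
  | a11 : IsListed (A113 F)
  | a12 : IsListed (A123 F)

/-! An algebra carries two linear forms, the left trace u ↦ tr(L_u) and the right trace u ↦ tr(R_u).
Isomorphisms preserve both, and passing to the opposite algebra swaps them. So an isomorphism g from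
the opposite algebra gives right = left ∘ g and left = right ∘ g, and three cases remain: the forms
are independent, or left = l · right ≠ 0 with l² = 1, or both vanish.

Independent forms serve as coordinates; g must then swap the basis, which leaves the `A13` family.
If left = l · right, take the right trace as first coordinate. Only e₁ ↦ e₁ + c e₂, e₂ ↦ d e₂ remain
free, and they lead to `normal_form_of_trace`. For l = 1 the algebra is commutative and every form
survives; for l = -1 the equations for g fix the parameters, except in `A33`. If both forms vanish,
the algebra is commutative, and in characteristic 3 the determinant of (u, u · u) is a cubic form s
x³ - r y³; a cube root gives e₂ with e₂e₂ ∈ F e₂, after which shifting and scaling suffice.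

The same trace equations, with the structure equations, separate the listed algebras. -/

/-- The linear map with matrix `(a b; c d)` is an isomorphism from the algebra with structure
matrix `A` onto the one with structure matrix `B`. -/
structure IsTransition {F : Type*} [Field F] (A B : Matrix (Fin 2) (Fin 4) F) (a b c d : F) :
    Prop where
  det : a * d - b * c ≠ 0
  h110 : a * A 0 0 + b * A 1 0 = B 0 0 * (a * a) + B 0 1 * (a * c) + B 0 2 * (c * a) + B 0 3 * (c * c)
  h111 : c * A 0 0 + d * A 1 0 = B 1 0 * (a * a) + B 1 1 * (a * c) + B 1 2 * (c * a) + B 1 3 * (c * c)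
  h120 : a * A 0 1 + b * A 1 1 = B 0 0 * (a * b) + B 0 1 * (a * d) + B 0 2 * (c * b) + B 0 3 * (c * d)
  h121 : c * A 0 1 + d * A 1 1 = B 1 0 * (a * b) + B 1 1 * (a * d) + B 1 2 * (c * b) + B 1 3 * (c * d)
  h210 : a * A 0 2 + b * A 1 2 = B 0 0 * (b * a) + B 0 1 * (b * c) + B 0 2 * (d * a) + B 0 3 * (d * c)
  h211 : c * A 0 2 + d * A 1 2 = B 1 0 * (b * a) + B 1 1 * (b * c) + B 1 2 * (d * a) + B 1 3 * (d * c)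
  h220 : a * A 0 3 + b * A 1 3 = B 0 0 * (b * b) + B 0 1 * (b * d) + B 0 2 * (d * b) + B 0 3 * (d * d)
  h221 : c * A 0 3 + d * A 1 3 = B 1 0 * (b * b) + B 1 1 * (b * d) + B 1 2 * (d * b) + B 1 3 * (d * d)

/-! ### Isomorphisms in coordinates and the trace forms -/

section
variable {F : Type*} [Field F] {V W X : Type*} [AddCommGroup V] [Module F V] [AddCommGroup W]
  [Module F W] [AddCommGroup X] [Module F X]

theorem AlgIso.refl (μ : LinearMap.BilinMap F V V) : AlgIso μ μ :=
  ⟨LinearEquiv.refl F V, fun _ _ => rfl⟩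

theorem AlgIso.symm {μ : LinearMap.BilinMap F V V} {ν : LinearMap.BilinMap F W W}
    (h : AlgIso μ ν) : AlgIso ν μ := by
  obtain ⟨e, he⟩ := h
  exact ⟨e.symm, fun u v => by rw [LinearEquiv.symm_apply_eq, he]; simp⟩

theorem AlgIso.trans {μ : LinearMap.BilinMap F V V} {ν : LinearMap.BilinMap F W W}
    {ξ : LinearMap.BilinMap F X X} (h : AlgIso μ ν) (k : AlgIso ν ξ) : AlgIso μ ξ := by
  obtain ⟨e, he⟩ := h
  obtain ⟨f, hf⟩ := k
  exact ⟨e.trans f, fun u v => by simp [he, hf]⟩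

theorem AlgIso.opp {μ : LinearMap.BilinMap F V V} {ν : LinearMap.BilinMap F W W}
    (h : AlgIso μ ν) : AlgIso (oppAlg μ) (oppAlg ν) := by
  obtain ⟨e, he⟩ := h
  exact ⟨e, fun u v => by simp [oppAlg, he]⟩

theorem AlgIso.ne_zero {μ : LinearMap.BilinMap F V V} {ν : LinearMap.BilinMap F W W}
    (h : AlgIso μ ν) (hν : ν ≠ 0) : μ ≠ 0 := by
  rintro rfl
  obtain ⟨e, he⟩ := h
  apply hν
  ext u v
  simpa using (he (e.symm u) (e.symm v)).symm

theorem AlgIso.self_opp {μ : LinearMap.BilinMap F V V} {ν : LinearMap.BilinMap F W W}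
    (h : AlgIso μ ν) (hν : AlgIso (oppAlg ν) ν) : AlgIso (oppAlg μ) μ :=
  (h.opp.trans hν).trans h.symm

/-- The structure matrix of the opposite algebra. -/
def oppMatrix (A : Matrix (Fin 2) (Fin 4) F) : Matrix (Fin 2) (Fin 4) F :=
  !![A 0 0, A 0 2, A 0 1, A 0 3; A 1 0, A 1 2, A 1 1, A 1 3]

theorem mscAlg_apply (A : Matrix (Fin 2) (Fin 4) F) (u v : Fin 2 → F) (k : Fin 2) :
    mscAlg A u v k = A k 0 * (u 0 * v 0) + A k 1 * (u 0 * v 1) + A k 2 * (u 1 * v 0)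
      + A k 3 * (u 1 * v 1) := by
  simp [mscAlg, Matrix.mulVec, dotProduct, Fin.sum_univ_four]

theorem oppAlg_mscAlg (A : Matrix (Fin 2) (Fin 4) F) :
    oppAlg (mscAlg A) = mscAlg (oppMatrix A) := by
  refine LinearMap.ext₂ fun u v => ?_
  ext k
  have : oppAlg (mscAlg A) u v = mscAlg A v u := rfl
  rw [this, mscAlg_apply, mscAlg_apply]
  fin_cases k <;> simp [oppMatrix] <;> ring

theorem mscAlg_ne_zero {A : Matrix (Fin 2) (Fin 4) F} (k : Fin 2) (l : Fin 4) (h : A k l ≠ 0) :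
    mscAlg A ≠ 0 := by
  intro h0
  have := mscAlg_basis A
  rw [h0] at this
  obtain ⟨h1, h2, h3, h4⟩ := this
  apply h
  have e1 := congrFun h1 k
  have e2 := congrFun h2 k
  have e3 := congrFun h3 k
  have e4 := congrFun h4 k
  fin_cases k <;> fin_cases l <;> simp_all

theorem mscAlg_eq_zero {A : Matrix (Fin 2) (Fin 4) F} (h : ∀ k l, A k l = 0) : mscAlg A = 0 := by
  refine LinearMap.ext₂ fun u v => ?_
  ext k
  rw [mscAlg_apply]
  simp [h]

theorem algIso_mscAlg_iff (A B : Matrix (Fin 2) (Fin 4) F) :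
    AlgIso (mscAlg A) (mscAlg B) ↔ ∃ a b c d, IsTransition A B a b c d := by
  constructor
  · rintro ⟨e, he⟩
    set x := e ![1, 0] with hx
    set y := e ![0, 1] with hy
    have hlin : ∀ s t : F, e ![s, t] = s • x + t • y := by
      intro s t
      rw [hx, hy, ← map_smul, ← map_smul, ← map_add]
      congr 1
      ext k; fin_cases k <;> simp
    obtain ⟨m1, m2, m3, m4⟩ := mscAlg_basis A
    have k1 := he ![1, 0] ![1, 0]
    have k2 := he ![1, 0] ![0, 1]
    have k3 := he ![0, 1] ![1, 0]
    have k4 := he ![0, 1] ![0, 1]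
    rw [m1, hlin, ← hx] at k1
    rw [m2, hlin, ← hx, ← hy] at k2
    rw [m3, hlin, ← hx, ← hy] at k3
    rw [m4, hlin, ← hy] at k4
    have key : ∀ {z w : Fin 2 → F}, z = w → z 0 = w 0 ∧ z 1 = w 1 := by
      rintro z w rfl; exact ⟨rfl, rfl⟩
    have l1 := key k1
    have l2 := key k2
    have l3 := key k3
    have l4 := key k4
    simp only [mscAlg_apply, Pi.add_apply, Pi.smul_apply, smul_eq_mul] at l1 l2 l3 l4
    refine ⟨x 0, y 0, x 1, y 1, ⟨?_, ?_, ?_, ?_, ?_, ?_, ?_, ?_, ?_⟩⟩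
    · intro hD
      -- The entries of y₁x - x₁y and y₀x - x₀y are 0 or ± the determinant.
      have z1 : e ![y 1, - x 1] = 0 := by
        rw [hlin]; ext k; fin_cases k <;> simp <;>
          first | ring1 | linear_combination hD
      have z2 : e ![y 0, - x 0] = 0 := by
        rw [hlin]; ext k; fin_cases k <;> simp <;>
          first | ring1 | linear_combination hD | linear_combination -hD
      rw [LinearEquiv.map_eq_zero_iff] at z1 z2
      have x1 : x 1 = 0 := by simpa using congrFun z1 1
      have x0 : x 0 = 0 := by simpa using congrFun z2 1
      have : x = 0 := by ext k; fin_cases k <;> simp [x0, x1]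
      rw [hx, LinearEquiv.map_eq_zero_iff] at this
      simpa using congrFun this 0
    · linear_combination l1.1
    · linear_combination l1.2
    · linear_combination l2.1
    · linear_combination l2.2
    · linear_combination l3.1
    · linear_combination l3.2
    · linear_combination l4.1
    · linear_combination l4.2
  · rintro ⟨a, b, c, d, h⟩
    have hdet : IsUnit (!![a, b; c, d] : Matrix (Fin 2) (Fin 2) F).det := by
      rw [Matrix.det_fin_two_of]; exact h.det.isUnit
    refine ⟨Matrix.toLinearEquiv' _ ((Matrix.isUnit_iff_isUnit_det _).2 hdet).invertible, ?_⟩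
    intro u v
    change (Matrix.toLin' !![a, b; c, d]) _ =
      mscAlg B (Matrix.toLin' !![a, b; c, d] u) (Matrix.toLin' !![a, b; c, d] v)
    ext k
    rw [mscAlg_apply]
    simp only [Matrix.toLin'_apply, Matrix.mulVec, dotProduct, Fin.sum_univ_two, mscAlg_apply]
    fin_cases k
    · simp
      linear_combination (u 0 * v 0) * h.h110 + (u 0 * v 1) * h.h120 + (u 1 * v 0) * h.h210 +
        (u 1 * v 1) * h.h220
    · simp
      linear_combination (u 0 * v 0) * h.h111 + (u 0 * v 1) * h.h121 + (u 1 * v 0) * h.h211 +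
        (u 1 * v 1) * h.h221

theorem IsTransition.algIso {A B : Matrix (Fin 2) (Fin 4) F} {a b c d : F}
    (h : IsTransition A B a b c d) : AlgIso (mscAlg A) (mscAlg B) :=
  (algIso_mscAlg_iff A B).2 ⟨a, b, c, d, h⟩

/-- Every two-dimensional algebra has a structure matrix. -/
theorem exists_algIso_mscAlg (hV : Module.finrank F V = 2) (μ : LinearMap.BilinMap F V V) :
    ∃ A : Matrix (Fin 2) (Fin 4) F, AlgIso μ (mscAlg A) := by
  have : FiniteDimensional F V := Module.finite_of_finrank_eq_succ hV
  let b := Module.finBasisOfFinrankEq F V hV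
  let e := b.equivFun
  refine ⟨!![e (μ (b 0) (b 0)) 0, e (μ (b 0) (b 1)) 0, e (μ (b 1) (b 0)) 0, e (μ (b 1) (b 1)) 0;
    e (μ (b 0) (b 0)) 1, e (μ (b 0) (b 1)) 1, e (μ (b 1) (b 0)) 1, e (μ (b 1) (b 1)) 1], e, ?_⟩
  intro u v
  have hu : u = e u 0 • b 0 + e u 1 • b 1 := by
    rw [← Fin.sum_univ_two (fun i => e u i • b i)]; exact (b.sum_equivFun u).symm
  have hv : v = e v 0 • b 0 + e v 1 • b 1 := by
    rw [← Fin.sum_univ_two (fun i => e v i • b i)]; exact (b.sum_equivFun v).symm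
  ext k
  rw [mscAlg_apply]
  generalize e u 0 = u0, e u 1 = u1, e v 0 = v0, e v 1 = v1 at *
  rw [hu, hv]
  simp only [map_add, map_smul, LinearMap.add_apply, LinearMap.smul_apply, Pi.add_apply,
    Pi.smul_apply, smul_eq_mul]
  fin_cases k <;> simp <;> ring

/-- Transport of structure along an invertible change of basis. -/
theorem exists_isTransition (A : Matrix (Fin 2) (Fin 4) F) {a b c d : F}
    (h : a * d - b * c ≠ 0) : ∃ B, IsTransition B A a b c d := by
  have key : ∀ x y : F, ∃ s t, a * s + b * t = x ∧ c * s + d * t = y := fun x y =>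
    ⟨(d * x - b * y) * (a * d - b * c)⁻¹, (a * y - c * x) * (a * d - b * c)⁻¹,
      by linear_combination x * mul_inv_cancel₀ h, by linear_combination y * mul_inv_cancel₀ h⟩
  -- The right-hand sides stay open until the fields of `IsTransition` determine them.
  obtain ⟨s1, t1, h1, k1⟩ := key _ _
  obtain ⟨s2, t2, h2, k2⟩ := key _ _
  obtain ⟨s3, t3, h3, k3⟩ := key _ _
  obtain ⟨s4, t4, h4, k4⟩ := key _ _
  exact ⟨!![s1, s2, s3, s4; t1, t2, t3, t4], ⟨h, h1, k1, h2, k2, h3, k3, h4, k4⟩⟩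

/-- Trace is invariant under conjugation: L_u = g⁻¹ L_{gu} g. The combination below is this identity
multiplied by det g, with the adjugate in place of g⁻¹. -/
theorem IsTransition.left_trace_zero {A B : Matrix (Fin 2) (Fin 4) F} {a b c d : F}
    (h : IsTransition A B a b c d) :
    A 0 0 + A 1 1 = (B 0 0 + B 1 1) * a + (B 0 2 + B 1 3) * c := by
  apply mul_left_cancel₀ h.det
  linear_combination d * h.h110 - b * h.h111 - c * h.h120 + a * h.h121

theorem IsTransition.left_trace_one {A B : Matrix (Fin 2) (Fin 4) F} {a b c d : F}
    (h : IsTransition A B a b c d) :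
    A 0 2 + A 1 3 = (B 0 0 + B 1 1) * b + (B 0 2 + B 1 3) * d := by
  apply mul_left_cancel₀ h.det
  linear_combination d * h.h210 - b * h.h211 - c * h.h220 + a * h.h221

theorem IsTransition.right_trace_zero {A B : Matrix (Fin 2) (Fin 4) F} {a b c d : F}
    (h : IsTransition A B a b c d) :
    A 0 0 + A 1 2 = (B 0 0 + B 1 2) * a + (B 0 1 + B 1 3) * c := by
  apply mul_left_cancel₀ h.det
  linear_combination d * h.h110 - b * h.h111 - c * h.h210 + a * h.h211

theorem IsTransition.right_trace_one {A B : Matrix (Fin 2) (Fin 4) F} {a b c d : F}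
    (h : IsTransition A B a b c d) :
    A 0 1 + A 1 3 = (B 0 0 + B 1 2) * b + (B 0 1 + B 1 3) * d := by
  apply mul_left_cancel₀ h.det
  linear_combination d * h.h120 - b * h.h121 - c * h.h220 + a * h.h221

end

/-! ### The listed algebras: self-opposite and pairwise distinct -/

section
variable {F : Type*} [Field F]

theorem three_eq_zero [CharP F 3] : (3 : F) = 0 := by
  exact_mod_cast CharP.cast_eq_zero F 3

theorem IsListed.ne_zero {B : Matrix (Fin 2) (Fin 4) F} (h : IsListed B) : mscAlg B ≠ 0 := by
  cases h with
  | a1 x y =>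
    by_cases hx : x = 0
    · exact mscAlg_ne_zero 0 2 (by simp [A13, hx])
    · exact mscAlg_ne_zero 0 0 (by simp [A13, hx])
  | a2 => exact mscAlg_ne_zero 0 3 (by simp [A23])
  | a2_special => exact mscAlg_ne_zero 0 3 (by simp [A23])
  | a3_neg => exact mscAlg_ne_zero 0 1 (by simp [A33])
  | a3_pos => exact mscAlg_ne_zero 0 1 (by simp [A33])
  | a4 x =>
    by_cases hx : x = 0
    · exact mscAlg_ne_zero 1 1 (by simp [A43, hx])
    · exact mscAlg_ne_zero 0 0 (by simp [A43, hx])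
  | a4_special => exact mscAlg_ne_zero 1 1 (by simp [A43])
  | a5 => exact mscAlg_ne_zero 1 0 (by simp [A53])
  | a9 => exact mscAlg_ne_zero 0 1 (by simp [A93])
  | a10 => exact mscAlg_ne_zero 0 1 (by simp [A103])
  | a11 => exact mscAlg_ne_zero 0 0 (by simp [A113])
  | a12 => exact mscAlg_ne_zero 1 0 (by simp [A123])

theorem exists_sqrt (hroot : ∀ p : Polynomial F, p.natDegree = 2 ∨ p.natDegree = 3 →
    ∃ x : F, p.IsRoot x) (a : F) : ∃ x, x ^ 2 = a := by
  obtain ⟨x, hx⟩ := hroot (Polynomial.X ^ 2 - Polynomial.C a)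
    (Or.inl (Polynomial.natDegree_X_pow_sub_C))
  exact ⟨x, by simpa [sub_eq_zero] using hx⟩

theorem exists_cbrt (hroot : ∀ p : Polynomial F, p.natDegree = 2 ∨ p.natDegree = 3 →
    ∃ x : F, p.IsRoot x) (a : F) : ∃ x, x ^ 3 = a := by
  obtain ⟨x, hx⟩ := hroot (Polynomial.X ^ 3 - Polynomial.C a)
    (Or.inr (Polynomial.natDegree_X_pow_sub_C))
  exact ⟨x, by simpa [sub_eq_zero] using hx⟩

/-- Swapping the basis reverses the `A13` family, e₁ ↦ -e₁ reverses those with left trace = -right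
trace, and the others are commutative. -/
theorem IsListed.self_opp [CharP F 3]
    (hsq : ∀ a : F, ∃ x, x ^ 2 = a)
    {B : Matrix (Fin 2) (Fin 4) F} (h : IsListed B) :
    AlgIso (oppAlg (mscAlg B)) (mscAlg B) := by
  have h3 := three_eq_zero (F := F)
  rw [oppAlg_mscAlg]
  cases h with
  | a1 x y =>
    refine IsTransition.algIso (a := 0) (b := 1) (c := 1) (d := 0) ?_
    constructor <;> simp [oppMatrix, A13]
  | a2_special =>
    -- Since e₂e₂ = e₁ ↦ -e₁, the scaling t of e₂ must satisfy t² = -1.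
    obtain ⟨t, ht⟩ := hsq (-1)
    have : t ≠ 0 := by rintro rfl; simp at ht
    refine IsTransition.algIso (a := -1) (b := 0) (c := 0) (d := t) ?_
    constructor <;> simp [oppMatrix, A23, this]
    linear_combination -ht
  | a3_neg z =>
    refine IsTransition.algIso (a := -1) (b := 0) (c := 0) (d := 1) ?_
    constructor <;> simp [oppMatrix, A33]
  | a4_special =>
    refine IsTransition.algIso (a := -1) (b := 0) (c := 0) (d := 1) ?_
    constructor <;> simp [oppMatrix, A43]
  | a5 =>
    refine IsTransition.algIso (a := -1) (b := 0) (c := 0) (d := 1) ?_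
    constructor <;> simp [oppMatrix, A53]
  | _ =>
    refine IsTransition.algIso (a := 1) (b := 0) (c := 0) (d := 1) ?_
    constructor <;> simp [oppMatrix, A23, A33, A43, A93, A103, A113, A123]

set_option maxHeartbeats 2000000 in
theorem IsListed.eq_of_isTransition [CharP F 3] {B C : Matrix (Fin 2) (Fin 4) F}
    (hB : IsListed B) (hC : IsListed C) {a b c d : F} (h : IsTransition B C a b c d) :
    B = C ∨ ∃ α₁ β₁ : F, B = A23 α₁ β₁ (1 - α₁) ∧ C = A23 α₁ (-β₁) (1 - α₁) := by
  have h3 := three_eq_zero (F := F)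
  have t1 := h.left_trace_zero
  have t2 := h.left_trace_one
  have t3 := h.right_trace_zero
  have t4 := h.right_trace_one
  obtain ⟨hd, h1, h2, h4, h5, h6, h7, h8, h9⟩ := h
  rcases hB with ⟨x, y⟩ | ⟨x, y⟩ | _ | ⟨x⟩ | ⟨x⟩ | ⟨x⟩ | _ | _ | _ | _ | _ | _ <;>
  rcases hC with ⟨x', y'⟩ | ⟨x', y'⟩ | _ | ⟨x'⟩ | ⟨x'⟩ | ⟨x'⟩ | _ | _ | _ | _ | _ | _ <;>
  simp [A13, A23, A33, A43, A53, A93, A103, A113, A123] at t1 t2 t3 t4 <;>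
  first
  -- The trace equations are linear in a, b, c, d; where they already conflict, the quadratic ones
  -- are not needed.
  | (exfalso; clear h1 h2 h4 h5 h6 h7 h8 h9; clear hd; grind)
  | (simp [A13, A23, A33, A43, A53, A93, A103, A113, A123] at hd h1 h2 h4 h5 h6 h7 h8 h9 ⊢ <;>
      grind)
end

/-! ### Completeness of the list, by the position of the trace forms -/

theorem ext_of_entries {F : Type*} {A : Matrix (Fin 2) (Fin 4) F} {p₁ p₂ p₃ p₄ q₁ q₂ q₃ q₄ : F}
    (h₁ : A 0 0 = p₁) (h₂ : A 0 1 = p₂) (h₃ : A 0 2 = p₃) (h₄ : A 0 3 = p₄)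
    (k₁ : A 1 0 = q₁) (k₂ : A 1 1 = q₂) (k₃ : A 1 2 = q₃) (k₄ : A 1 3 = q₄) :
    A = !![p₁, p₂, p₃, p₄; q₁, q₂, q₃, q₄] := by
  ext i j
  fin_cases i <;> fin_cases j <;> assumption

section
variable {F : Type*} [Field F]

/-- Normal forms of the algebras whose left trace form is a multiple `l` of a nonzero right trace
form, normalised to be the first coordinate. -/
theorem normal_form_of_trace (hsq : ∀ a : F, ∃ x, x ^ 2 = a) (h3 : (3 : F) = 0)
    {A : Matrix (Fin 2) (Fin 4) F} {l : F}
    (r0 : A 0 0 + A 1 2 = 1) (r1 : A 0 1 + A 1 3 = 0)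
    (l0 : A 0 0 + A 1 1 = l) (l1 : A 0 2 + A 1 3 = 0) :
    (∃ x y, AlgIso (mscAlg A) (mscAlg (A23 x y (l - x)))) ∨
    (∃ x, AlgIso (mscAlg A) (mscAlg (A33 x l))) ∨
    (∃ x, AlgIso (mscAlg A) (mscAlg (A43 x (l - x)))) ∨
    (l = -1 ∧ ∃ x, AlgIso (mscAlg A) (mscAlg (A53 x))) := by
  have h2 : (2 : F) ≠ 0 := fun h => one_ne_zero (α := F) (by linear_combination h3 - h)
  obtain ⟨p, hp⟩ : ∃ p, A 0 0 = p := ⟨_, rfl⟩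
  obtain ⟨q, hq⟩ : ∃ q, A 0 1 = q := ⟨_, rfl⟩
  obtain ⟨r, hr⟩ : ∃ r, A 0 3 = r := ⟨_, rfl⟩
  obtain ⟨s, hs⟩ : ∃ s, A 1 0 = s := ⟨_, rfl⟩
  rw [ext_of_entries (A := A) (p₁ := p) (p₂ := q) (p₃ := q) (p₄ := r) (q₁ := s) (q₂ := l - p)
    (q₃ := 1 - p) (q₄ := -q) hp hq (by linear_combination l1 - r1 + hq) hr hs
    (by linear_combination l0 - hp) (by linear_combination r0 - hp)
    (by linear_combination r1 - hq)]
  by_cases hr0 : r = 0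
  · subst hr0
    by_cases hq0 : q = 0
    · subst hq0
      right; right
      -- Replacing e₁ by e₁ + c e₂ turns s into s + (l + 1) c, as 3p = 0; so s can be removed unless
      -- l = -1.
      by_cases hl : l = -1
      · by_cases hs0 : s = 0
        · subst hs0
          left
          exact ⟨p, by rw [A43]; convert AlgIso.refl _ using 3; simp⟩
        · right
          refine ⟨hl, p, IsTransition.algIso (a := 1) (b := 0) (c := 0) (d := s⁻¹) ?_⟩
          constructor <;> simp [A53, hs0, hl]
          all_goals grind
      · left
        have hl' : l + 1 ≠ 0 := fun h => hl (by linear_combination h)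
        refine ⟨p, (IsTransition.algIso (a := 1) (b := 0) (c := -s / (l + 1)) (d := 1) ?_).symm⟩
        constructor <;> simp [A43]
        all_goals field_simp
        all_goals grind
    · right; left
      -- The shift c = p / q turns the e₁-coefficient p of e₁e₁ into p + 2qc = 3p = 0.
      refine ⟨q * s + p * (l + 1), (IsTransition.algIso (a := 1) (b := 0) (c := p / q) (d := q⁻¹) ?_).symm⟩
      constructor <;> simp [A33, hq0]
      all_goals field_simp
      all_goals grind
  · left
    obtain ⟨t, ht⟩ := hsq r
    have ht0 : t ≠ 0 := by rintro rfl; simp at ht; exact hr0 ht.symm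
    subst ht
    -- With e₂' = t⁻¹ e₂, this c makes e₁' = e₂'e₂'.
    obtain ⟨B, hB⟩ := exists_isTransition !![p, q, q, t ^ 2; s, l - p, 1 - p, -q]
      (a := 1) (b := 0) (c := -q / t ^ 2) (d := t⁻¹) (by simpa using ht0)
    have t1 := hB.left_trace_zero
    have t2 := hB.left_trace_one
    have t3 := hB.right_trace_zero
    have t4 := hB.right_trace_one
    refine ⟨B 0 0, B 1 0, ?_⟩
    have e2 := hB.h120
    have e3 := hB.h220
    simp at e2 e3 t1 t2 t3 t4
    have e2' : B 0 1 = 0 := by rw [e2]; field_simp; ring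
    have e3' : B 0 3 = 1 := by rw [e3]; field_simp
    have : B = A23 (B 0 0) (B 1 0) (l - B 0 0) :=
      ext_of_entries rfl e2' (by linear_combination t2 - t4 + e2') e3' rfl
        (by linear_combination t1) (by linear_combination t3) (by linear_combination t4 - e2')
    rw [← this]
    exact hB.algIso.symm

theorem IsTransition.opp_trace {A : Matrix (Fin 2) (Fin 4) F} {a b c d : F}
    (h : IsTransition (oppMatrix A) A a b c d) :
    A 0 0 + A 1 2 = (A 0 0 + A 1 1) * a + (A 0 2 + A 1 3) * c ∧
    A 0 1 + A 1 3 = (A 0 0 + A 1 1) * b + (A 0 2 + A 1 3) * d ∧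
    A 0 0 + A 1 1 = (A 0 0 + A 1 2) * a + (A 0 1 + A 1 3) * c ∧
    A 0 2 + A 1 3 = (A 0 0 + A 1 2) * b + (A 0 1 + A 1 3) * d :=
  ⟨by simpa [oppMatrix] using h.left_trace_zero, by simpa [oppMatrix] using h.left_trace_one,
    by simpa [oppMatrix] using h.right_trace_zero, by simpa [oppMatrix] using h.right_trace_one⟩

theorem exists_transition_of_self_opp {A B : Matrix (Fin 2) (Fin 4) F}
    (h : AlgIso (oppAlg (mscAlg A)) (mscAlg A)) (k : AlgIso (mscAlg B) (mscAlg A)) :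
    ∃ a b c d, IsTransition (oppMatrix B) B a b c d := by
  rw [← algIso_mscAlg_iff, ← oppAlg_mscAlg]
  exact k.self_opp h

theorem exists_listed_of_independent_traces {A : Matrix (Fin 2) (Fin 4) F}
    (h : AlgIso (oppAlg (mscAlg A)) (mscAlg A))
    (hi : (A 0 0 + A 1 1) * (A 0 1 + A 1 3) - (A 0 2 + A 1 3) * (A 0 0 + A 1 2) ≠ 0) :
    ∃ B, IsListed B ∧ AlgIso (mscAlg A) (mscAlg B) := by
  obtain ⟨m, hm⟩ : ∃ m, ((A 0 0 + A 1 1) * (A 0 1 + A 1 3) -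
    (A 0 2 + A 1 3) * (A 0 0 + A 1 2)) * m = 1 := ⟨_, mul_inv_cancel₀ hi⟩
  have hm0 : m ≠ 0 := by rintro rfl; simp at hm
  -- The basis dual to (right trace, left trace).
  obtain ⟨B, hB⟩ := exists_isTransition A (a := -(A 0 2 + A 1 3) * m) (b := (A 0 1 + A 1 3) * m)
    (c := (A 0 0 + A 1 1) * m) (d := -(A 0 0 + A 1 2) * m) (by
      intro h0
      exact hm0 (by linear_combination -h0 - m * hm))
  have t1 : B 0 0 + B 1 1 = 0 := by rw [hB.left_trace_zero]; ring
  have t2 : B 0 2 + B 1 3 = 1 := by rw [hB.left_trace_one]; linear_combination hm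
  have t3 : B 0 0 + B 1 2 = 1 := by rw [hB.right_trace_zero]; linear_combination hm
  have t4 : B 0 1 + B 1 3 = 0 := by rw [hB.right_trace_one]; ring
  obtain ⟨a, b, c, d, k⟩ := exists_transition_of_self_opp h hB.algIso
  obtain ⟨s1, s2, s3, s4⟩ := k.opp_trace
  rw [t1, t2, t3] at s1
  rw [t1, t2, t4] at s2
  rw [t1, t3, t4] at s3
  rw [t2, t3, t4] at s4
  obtain rfl : c = 1 := by linear_combination -s1
  obtain rfl : d = 0 := by linear_combination -s2
  obtain rfl : a = 0 := by linear_combination -s3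
  obtain rfl : b = 1 := by linear_combination -s4
  have k1 := k.h110
  have k2 := k.h111
  simp [oppMatrix] at k1 k2
  refine ⟨_, IsListed.a1 (B 0 0) (B 0 3), ?_⟩
  have : B = A13 (B 0 0) (-B 0 0) (B 0 3) (B 0 3) :=
    ext_of_entries rfl (by linear_combination t4 + k2) (by linear_combination t2 + k2) rfl k1
      (by linear_combination t1) (by linear_combination t3) (by linear_combination -k2)
  rw [← this]
  exact hB.algIso.symm

theorem exists_listed_of_right_trace_ne_zero (hsq : ∀ a : F, ∃ x, x ^ 2 = a) (h3 : (3 : F) = 0)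
    {A : Matrix (Fin 2) (Fin 4) F} {l : F} (hl : l = 1 ∨ l = -1)
    (h : AlgIso (oppAlg (mscAlg A)) (mscAlg A))
    (hr : ¬ (A 0 0 + A 1 2 = 0 ∧ A 0 1 + A 1 3 = 0))
    (l0 : A 0 0 + A 1 1 = l * (A 0 0 + A 1 2)) (l1 : A 0 2 + A 1 3 = l * (A 0 1 + A 1 3)) :
    ∃ B, IsListed B ∧ AlgIso (mscAlg A) (mscAlg B) := by
  obtain ⟨a, b, c, d, hd, ha, hb⟩ : ∃ a b c d : F, a * d - b * c ≠ 0 ∧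
      (A 0 0 + A 1 2) * a + (A 0 1 + A 1 3) * c = 1 ∧
      (A 0 0 + A 1 2) * b + (A 0 1 + A 1 3) * d = 0 := by
    generalize A 0 0 + A 1 2 = u at *
    generalize A 0 1 + A 1 3 = v at *
    by_cases hu : u = 0
    · have hv : v ≠ 0 := fun hv => hr ⟨hu, hv⟩
      exact ⟨0, 1, v⁻¹, 0, by simpa using hv, by simp [hv], by simp [hu]⟩
    · exact ⟨u⁻¹, -v, 0, u, by simpa using hu, by simp [hu], by ring⟩
  obtain ⟨B, hB⟩ := exists_isTransition A hd
  have key := normal_form_of_trace hsq h3 (A := B) (l := l) (by rw [hB.right_trace_zero, ha])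
    (by rw [hB.right_trace_one, hb])
    (by rw [hB.left_trace_zero, l0, l1]; linear_combination l * ha)
    (by rw [hB.left_trace_one, l0, l1]; linear_combination l * hb)
  have tr : ∀ {C}, AlgIso (mscAlg B) (mscAlg C) → AlgIso (mscAlg A) (mscAlg C) :=
    fun k => hB.algIso.symm.trans k
  have so : ∀ {C}, AlgIso (mscAlg B) (mscAlg C) →
      ∃ a b c d, IsTransition (oppMatrix C) C a b c d :=
    fun k => exists_transition_of_self_opp h (tr k).symm
  have h2 : (2 : F) ≠ 0 := fun h => one_ne_zero (α := F) (by linear_combination h3 - h)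
  rcases hl with rfl | rfl
  · rcases key with ⟨x, y, k⟩ | ⟨x, k⟩ | ⟨x, k⟩ | ⟨hl, -⟩
    · exact ⟨_, .a2 x y, tr k⟩
    · exact ⟨_, .a3_pos x, tr k⟩
    · exact ⟨_, .a4 x, tr k⟩
    · exact absurd (by linear_combination hl) h2
  · rcases key with ⟨x, y, k⟩ | ⟨x, k⟩ | ⟨x, k⟩ | ⟨-, x, k⟩
    · obtain ⟨a, b, c, d, m⟩ := so k
      obtain ⟨s1, s2, s3, s4⟩ := m.opp_trace
      obtain ⟨hd, h1, h2, h4, h5, h6, h7, h8, h9⟩ := m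
      simp [A23, oppMatrix] at *
      -- The traces give a = -1, b = 0; then e₂e₂ = e₁ forces c = 0, d² = -1, and e₁e₁ gives 2x = 0
      -- and dy = y, where d ≠ 1.
      obtain ⟨rfl, rfl⟩ : x = 0 ∧ y = 0 := by grind
      exact ⟨_, .a2_special, tr (by simpa [A23] using k)⟩
    · exact ⟨_, .a3_neg x, tr k⟩
    · obtain ⟨a, b, c, d, m⟩ := so k
      obtain ⟨s1, s2, s3, s4⟩ := m.opp_trace
      obtain ⟨hd, h1, h2, h4, h5, h6, h7, h8, h9⟩ := m
      simp [A43, oppMatrix] at *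
      obtain rfl : x = 0 := by grind
      exact ⟨_, .a4_special, tr (by simpa [A43] using k)⟩
    · obtain ⟨a, b, c, d, m⟩ := so k
      obtain ⟨s1, s2, s3, s4⟩ := m.opp_trace
      obtain ⟨hd, h1, h2, h4, h5, h6, h7, h8, h9⟩ := m
      simp [A53, oppMatrix] at *
      obtain rfl : x = 0 := by grind
      exact ⟨_, .a5, tr (by simpa [A53] using k)⟩

/-- The remaining case: the algebra is commutative and its trace form vanishes. -/
theorem exists_listed_of_traces_eq_zero (hsq : ∀ a : F, ∃ x, x ^ 2 = a)
    (hcb : ∀ a : F, ∃ x, x ^ 3 = a) (h3 : (3 : F) = 0)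
    {A : Matrix (Fin 2) (Fin 4) F} (h0 : mscAlg A ≠ 0)
    (r0 : A 0 0 + A 1 2 = 0) (r1 : A 0 1 + A 1 3 = 0)
    (l0 : A 0 0 + A 1 1 = 0) (l1 : A 0 2 + A 1 3 = 0) :
    ∃ B, IsListed B ∧ AlgIso (mscAlg A) (mscAlg B) := by
  have h2 : (2 : F) ≠ 0 := fun h => one_ne_zero (α := F) (by linear_combination h3 - h)
  -- The new e₂ is (b, d), a zero of the cubic form s x³ - r y³, hence proportional to its own
  -- square.
  obtain ⟨a, b, c, d, hd, hbd⟩ : ∃ a b c d : F, a * d - b * c ≠ 0 ∧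
      A 1 0 * b ^ 3 = A 0 3 * d ^ 3 := by
    by_cases hs : A 1 0 = 0
    · exact ⟨0, 1, 1, 0, by simp, by simp [hs]⟩
    · obtain ⟨t, ht⟩ := hcb (A 0 3 / A 1 0)
      exact ⟨1, t, 0, 1, by simp, by rw [ht]; field_simp⟩
  obtain ⟨B, hB⟩ := exists_isTransition A hd
  have t1 : B 0 0 + B 1 1 = 0 := by rw [hB.left_trace_zero, l0, l1]; ring
  have t2 : B 0 2 + B 1 3 = 0 := by rw [hB.left_trace_one, l0, l1]; ring
  have t3 : B 0 0 + B 1 2 = 0 := by rw [hB.right_trace_zero, r0, r1]; ring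
  have t4 : B 0 1 + B 1 3 = 0 := by rw [hB.right_trace_one, r0, r1]; ring
  have hr : B 0 3 = 0 := by
    apply mul_left_cancel₀ hd
    have e0 := hB.h220
    have e1 := hB.h221
    grind
  have hB0 : mscAlg B ≠ 0 := hB.algIso.ne_zero h0
  suffices ∃ C, IsListed C ∧ AlgIso (mscAlg B) (mscAlg C) by
    obtain ⟨C, hC, k⟩ := this
    exact ⟨C, hC, hB.algIso.symm.trans k⟩
  obtain ⟨p, hp⟩ : ∃ p, B 0 0 = p := ⟨_, rfl⟩
  obtain ⟨q, hq⟩ : ∃ q, B 0 1 = q := ⟨_, rfl⟩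
  obtain ⟨s, hs⟩ : ∃ s, B 1 0 = s := ⟨_, rfl⟩
  have hBe := ext_of_entries (A := B) (p₁ := p) (p₂ := q) (p₃ := q) (p₄ := 0) (q₁ := s) (q₂ := -p)
    (q₃ := -p) (q₄ := -q) hp hq (by linear_combination t2 - t4 + hq) hr hs
    (by linear_combination t1 - hp) (by linear_combination t3 - hp)
    (by linear_combination t4 - hq)
  rw [hBe] at hB0 ⊢
  clear hBe hp hq hs hr t1 t2 t3 t4 hB
  by_cases hq0 : q = 0
  · subst hq0
    by_cases hp0 : p = 0
    · subst hp0
      have hs0 : s ≠ 0 := by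
        rintro rfl
        exact hB0 (mscAlg_eq_zero fun k l => by fin_cases k <;> fin_cases l <;> simp)
      refine ⟨_, .a12, IsTransition.algIso (a := 1) (b := 0) (c := 0) (d := s⁻¹) ?_⟩
      constructor <;> simp [A123, hs0]
    · by_cases hs0 : s = 0
      · subst hs0
        refine ⟨_, .a10, (IsTransition.algIso (a := 0) (b := -p⁻¹) (c := 1) (d := 0) ?_).symm⟩
        constructor <;> simp [A103, hp0]
      · refine ⟨_, .a11, (IsTransition.algIso (a := p⁻¹) (b := 0) (c := 0) (d := s / p ^ 2)
          ?_).symm⟩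
        constructor <;> simp [A113, hp0, hs0]
        all_goals field_simp
  · by_cases hs0 : s = 0
    · subst hs0
      refine ⟨_, .a10, (IsTransition.algIso (a := 1) (b := 0) (c := p / q) (d := q⁻¹) ?_).symm⟩
      constructor <;> simp [A103, hq0]
      all_goals field_simp
      all_goals grind
    -- With e₁ scaled by r and e₂ by q⁻¹, the relation e₁e₁ = e₂ requires r² s = q⁻¹.
    · obtain ⟨r, hr⟩ := hsq (q * s)⁻¹
      have hrs : r ^ 2 * q * s = 1 := by rw [hr]; field_simp
      have hr0 : r ≠ 0 := by rintro rfl; simp at hrs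
      refine ⟨_, .a9, (IsTransition.algIso (a := r) (b := 0) (c := r * p / q) (d := q⁻¹) ?_).symm⟩
      constructor <;> simp [A93, hq0, hr0]
      all_goals field_simp
      all_goals grind

end

/-! ### Assembling the classification -/

section
variable {F : Type*} [Field F]

theorem exists_listed_of_self_opp (hsq : ∀ a : F, ∃ x, x ^ 2 = a) (hcb : ∀ a : F, ∃ x, x ^ 3 = a)
    (h3 : (3 : F) = 0) {A : Matrix (Fin 2) (Fin 4) F} (h0 : mscAlg A ≠ 0)
    (h : AlgIso (oppAlg (mscAlg A)) (mscAlg A)) :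
    ∃ B, IsListed B ∧ AlgIso (mscAlg A) (mscAlg B) := by
  by_cases hi : (A 0 0 + A 1 1) * (A 0 1 + A 1 3) - (A 0 2 + A 1 3) * (A 0 0 + A 1 2) = 0
  · obtain ⟨a, b, c, d, k⟩ := exists_transition_of_self_opp h (AlgIso.refl _)
    obtain ⟨s1, s2, s3, s4⟩ := k.opp_trace
    by_cases hr : A 0 0 + A 1 2 = 0 ∧ A 0 1 + A 1 3 = 0
    · rw [hr.1, hr.2] at s3 s4
      exact exists_listed_of_traces_eq_zero hsq hcb h3 h0 hr.1 hr.2 (by simpa using s3)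
        (by simpa using s4)
    · obtain ⟨l, l0, l1⟩ : ∃ l, A 0 0 + A 1 1 = l * (A 0 0 + A 1 2) ∧
          A 0 2 + A 1 3 = l * (A 0 1 + A 1 3) := by
        by_cases hu : A 0 0 + A 1 2 = 0
        · have hv : A 0 1 + A 1 3 ≠ 0 := fun hv => hr ⟨hu, hv⟩
          refine ⟨(A 0 2 + A 1 3) / (A 0 1 + A 1 3), ?_, by field_simp⟩
          rw [hu] at hi ⊢
          simpa [hv] using hi
        · refine ⟨(A 0 0 + A 1 1) / (A 0 0 + A 1 2), by field_simp, ?_⟩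
          field_simp
          linear_combination -hi
      -- right = left ∘ g = l · (right ∘ g) = l · left = l² · right, and the right trace is nonzero.
      have hl : (l - 1) * (l + 1) = 0 := by
        by_contra hl
        refine hr ⟨mul_left_cancel₀ hl ?_, mul_left_cancel₀ hl ?_⟩
        · rw [l0, l1] at s1
          rw [l0] at s3
          linear_combination l * s3 - s1
        · rw [l0, l1] at s2
          rw [l1] at s4
          linear_combination l * s4 - s2
      refine exists_listed_of_right_trace_ne_zero hsq h3 ?_ h hr l0 l1
      rcases mul_eq_zero.1 hl with hl | hl
      · exact Or.inl (sub_eq_zero.1 hl)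
      · exact Or.inr (eq_neg_of_add_eq_zero_left hl)
  · exact exists_listed_of_independent_traces h hi

theorem A23_algIso_neg (x y : F) :
    AlgIso (mscAlg (A23 x y (1 - x))) (mscAlg (A23 x (-y) (1 - x))) := by
  refine IsTransition.algIso (a := 1) (b := 0) (c := 0) (d := -1) ?_
  constructor <;> simp [A23]

end

theorem mainTheorem10 {F : Type*} [Field F] [CharP F 3]
    (hroot : ∀ p : Polynomial F, p.natDegree = 2 ∨ p.natDegree = 3 → ∃ x : F, p.IsRoot x) :
    (∀ B : Matrix (Fin 2) (Fin 4) F, IsListed B →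
      mscAlg B ≠ 0 ∧ AlgIso (oppAlg (mscAlg B)) (mscAlg B)) ∧
    (∀ (V : Type*) [AddCommGroup V] [Module F V], Module.finrank F V = 2 →
      ∀ μ : LinearMap.BilinMap F V V,
        (μ ≠ 0 ∧ AlgIso (oppAlg μ) μ) ↔
          ∃ B : Matrix (Fin 2) (Fin 4) F, IsListed B ∧ AlgIso μ (mscAlg B)) ∧
    (∀ B C : Matrix (Fin 2) (Fin 4) F, IsListed B → IsListed C →
      (AlgIso (mscAlg B) (mscAlg C) ↔
        B = C ∨ ∃ α₁ β₁ : F, B = A23 α₁ β₁ (1 - α₁) ∧ C = A23 α₁ (-β₁) (1 - α₁))) := by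
  have hsq := exists_sqrt hroot
  refine ⟨fun B hB => ⟨hB.ne_zero, hB.self_opp hsq⟩, fun V _ _ hV μ => ⟨?_, ?_⟩,
    fun B C hB hC => ⟨?_, ?_⟩⟩
  · rintro ⟨h0, h⟩
    obtain ⟨A, hA⟩ := exists_algIso_mscAlg hV μ
    obtain ⟨B, hB, k⟩ := exists_listed_of_self_opp hsq (exists_cbrt hroot) three_eq_zero
      (hA.symm.ne_zero h0) (hA.symm.self_opp h)
    exact ⟨B, hB, hA.trans k⟩
  · rintro ⟨B, hB, k⟩
    exact ⟨k.ne_zero hB.ne_zero, k.self_opp (hB.self_opp hsq)⟩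
  · intro h
    obtain ⟨a, b, c, d, k⟩ := (algIso_mscAlg_iff B C).1 h
    exact hB.eq_of_isTransition hC k
  · rintro (rfl | ⟨x, y, rfl, rfl⟩)
    · exact AlgIso.refl _
    · exact A23_algIso_neg x y
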